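/- Let $k$ be a field and $\lambda\in k$ (in particular $k=\mathbb{C}$ with any $\lambda\in\mathbb{C}$, or $k=\mathbb{C}(\lambda)$ with $\lambda$ the variable). Let $Q$ be the quiver with two vertices $R$ and $M$, two loops $a,b$ at $M$, one arrow $c$ from $M$ to $R$ and one arrow $d$ from $R$ to $M$. Compose paths from right to left, and let $A$ be the path algebra $kQ$ modulo the two-sided ideal generated by $$(b^2+dc)d,\qquad c(b^2+dc),\qquad ab+ba,\qquad a^2+bdc+dcb+\lambda b^2+b^3 .$$ For a vertex $i$ let $e_i\in A$ be the trivial path at $i$ and let $P_i=e_iA$ be the right $A$-module spanned by the paths ending at $i$. Let $L_R$ be the vertex simple at $R$, that is, the one-dimensional right $A$-module on which $e_R$ acts as the identity and $e_M,a,b,c,d$ act as zero, and let $P_R\to L_R$ be the canonical map sending $e_R$ to $1$. Then $P_R$ and $P_M$ are projective right $A$-modules, and the sequence of right $A$-modules $$0\longrightarrow P_R\xrightarrow{\;d\;}P_M\xrightarrow{\;b^2+dc\;}P_M\xrightarrow{\;c\;}P_R\longrightarrow L_R\longrightarrow 0,$$ whose three maps between projectives are left multiplications by the indicated elements, is exact.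 Thus it is a projective resolution of $L_R$. -/

import Mathlib

universe u v w

/-- Generators of the path algebra of a quiver: the trivial paths (one for each vertex) and the
arrows. -/
inductive PathGen (V : Type v) [Quiver.{w} V] : Type (max v w)
  | vertex (i : V) : PathGen V
  | arrow {i j : V} (f : i ⟶ j) : PathGen V

/-- The defining relations of the path algebra of a quiver with finitely many vertices. Paths are
composed from right to left: for an arrow `f : i ⟶ j` one has `e_j f = f = f e_i`. -/
inductive PathRel (K : Type u) [Field K] (V : Type v) [Quiver.{w} V] [Fintype V] :
    FreeAlgebra K (PathGen V) → FreeAlgebra K (PathGen V) → Prop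
  | idem (i : V) :
      PathRel K V (FreeAlgebra.ι K (PathGen.vertex i) * FreeAlgebra.ι K (PathGen.vertex i))
        (FreeAlgebra.ι K (PathGen.vertex i))
  | orth (i j : V) (h : i ≠ j) :
      PathRel K V (FreeAlgebra.ι K (PathGen.vertex i) * FreeAlgebra.ι K (PathGen.vertex j)) 0
  | one : PathRel K V (∑ i : V, FreeAlgebra.ι K (PathGen.vertex i)) 1
  | target {i j : V} (f : i ⟶ j) :
      PathRel K V (FreeAlgebra.ι K (PathGen.vertex j) * FreeAlgebra.ι K (PathGen.arrow f))
        (FreeAlgebra.ι K (PathGen.arrow f))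
  | source {i j : V} (f : i ⟶ j) :
      PathRel K V (FreeAlgebra.ι K (PathGen.arrow f) * FreeAlgebra.ι K (PathGen.vertex i))
        (FreeAlgebra.ι K (PathGen.arrow f))

/-- The path algebra over `K` of a quiver with finitely many vertices. -/
abbrev PathAlg (K : Type u) [Field K] (V : Type v) [Quiver.{w} V] [Fintype V] :=
  RingQuot (PathRel K V)

namespace PathAlg

variable (K : Type u) [Field K] {V : Type v} [Quiver.{w} V] [Fintype V]

/-- The trivial path at a vertex. -/
noncomputable def idem (i : V) : PathAlg K V :=
  RingQuot.mkAlgHom K (PathRel K V) (FreeAlgebra.ι K (PathGen.vertex i))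

/-- An arrow as an element of the path algebra. -/
noncomputable def arrow {i j : V} (f : i ⟶ j) : PathAlg K V :=
  RingQuot.mkAlgHom K (PathRel K V) (FreeAlgebra.ι K (PathGen.arrow f))

open Classical in
/-- The value of the one-dimensional representation at the vertex `i` on a generator: the trivial
path at `i` acts as `1`, the other trivial paths and all arrows act as `0`. -/
noncomputable def genChar (i : V) : PathGen V → K
  | PathGen.vertex j => if j = i then 1 else 0
  | PathGen.arrow _ => 0

/-- The one-dimensional representation of the path algebra at the vertex `i`. -/
noncomputable def vertexChar (i : V) : PathAlg K V →ₐ[K] K :=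
  RingQuot.liftAlgHom K ⟨FreeAlgebra.lift K (genChar K i), by
    intro x y h
    induction h with
    | idem j => by_cases hj : j = i <;> simp [genChar, hj]
    | orth j k hjk =>
      by_cases hj : j = i
      · have hk : k ≠ i := fun hk => hjk (hj.trans hk.symm)
        simp [genChar, hj, hk]
      · simp [genChar, hj]
    | one =>
      simp only [map_sum, FreeAlgebra.lift_ι_apply, map_one, genChar]
      rw [Finset.sum_eq_single i (fun j _ hj => if_neg hj) (fun h => absurd (Finset.mem_univ i) h),
        if_pos rfl]
    | target f => simp [genChar]
    | source f => simp [genChar]⟩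

@[simp]
theorem vertexChar_arrow (i : V) {j k : V} (f : j ⟶ k) : vertexChar K i (arrow K f) = 0 := by
  simp [vertexChar, arrow, genChar]

@[simp]
theorem vertexChar_idem_self (i : V) : vertexChar K i (idem K i) = 1 := by
  simp [vertexChar, idem, genChar]

end PathAlg

namespace MorrisonPinkham

/-- The two vertices of the Morrison–Pinkham quiver. -/
inductive Vertex : Type
  | R
  | M
  deriving DecidableEq

instance : Fintype Vertex := ⟨{Vertex.R, Vertex.M}, by rintro (_ | _) <;> decide⟩

/-- The arrows: loops `a`, `b` at `M`, an arrow `c` from `M` to `R` and an arrow `d` from `R` to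
`M`. -/
inductive Arrow : Vertex → Vertex → Type
  | a : Arrow Vertex.M Vertex.M
  | b : Arrow Vertex.M Vertex.M
  | c : Arrow Vertex.M Vertex.R
  | d : Arrow Vertex.R Vertex.M

instance : Quiver.{0} Vertex := ⟨Arrow⟩

section Free

variable (K : Type u) [Field K]

/-- The path algebra of the quiver, before the relations are imposed. -/
abbrev P := PathAlg K Vertex

/-- The arrow `a` in the path algebra. -/
noncomputable def pa : P K := PathAlg.arrow K (i := Vertex.M) (j := Vertex.M) Arrow.a
/-- The arrow `b` in the path algebra. -/
noncomputable def pb : P K := PathAlg.arrow K (i := Vertex.M) (j := Vertex.M) Arrow.b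
/-- The arrow `c` in the path algebra. -/
noncomputable def pc : P K := PathAlg.arrow K (i := Vertex.M) (j := Vertex.R) Arrow.c
/-- The arrow `d` in the path algebra. -/
noncomputable def pd : P K := PathAlg.arrow K (i := Vertex.R) (j := Vertex.M) Arrow.d

end Free

variable (K : Type u) [Field K] (lam : K)

/-- The relations `(b² + dc)d = 0`, `c(b² + dc) = 0`, `ab + ba = 0` and
`a² + bdc + dcb + λb² + b³ = 0`. -/
inductive Rel : P K → P K → Prop
  | rel_c : Rel ((pb K ^ 2 + pd K * pc K) * pd K) 0
  | rel_d : Rel (pc K * (pb K ^ 2 + pd K * pc K)) 0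
  | rel_a : Rel (pa K * pb K + pb K * pa K) 0
  | rel_b : Rel (pa K ^ 2 + pb K * pd K * pc K + pd K * pc K * pb K + lam • pb K ^ 2 + pb K ^ 3) 0

/-- The Morrison–Pinkham quiver algebra: the path algebra modulo the two-sided ideal generated by
the relations. -/
abbrev A := RingQuot (Rel K lam)

/-- The quotient map from the path algebra. -/
noncomputable def quo : P K →ₐ[K] A K lam := RingQuot.mkAlgHom K (Rel K lam)

/-- The idempotent of a vertex in the quiver algebra. -/
noncomputable def e (i : Vertex) : A K lam := quo K lam (PathAlg.idem K i)
/-- The class of the loop `b`. -/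
noncomputable def b : A K lam := quo K lam (pb K)
/-- The class of the arrow `c`. -/
noncomputable def c : A K lam := quo K lam (pc K)
/-- The class of the arrow `d`. -/
noncomputable def d : A K lam := quo K lam (pd K)

theorem e_mul_e (i : Vertex) : e K lam i * e K lam i = e K lam i := by
  have h : PathAlg.idem K i * PathAlg.idem K i = PathAlg.idem K i := by
    simpa only [PathAlg.idem, map_mul] using RingQuot.mkAlgHom_rel K (PathRel.idem (K := K) i)
  simp only [e, ← map_mul, h]

theorem e_mul_arrow {i j : Vertex} (f : i ⟶ j) :
    e K lam j * quo K lam (PathAlg.arrow K f) = quo K lam (PathAlg.arrow K f) := by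
  have h : PathAlg.idem K j * PathAlg.arrow K f = PathAlg.arrow K f := by
    simpa only [PathAlg.idem, PathAlg.arrow, map_mul] using
      RingQuot.mkAlgHom_rel K (PathRel.target (K := K) f)
  simp only [e, ← map_mul, h]

theorem e_mul_b : e K lam Vertex.M * b K lam = b K lam := e_mul_arrow K lam _
theorem e_mul_c : e K lam Vertex.R * c K lam = c K lam := e_mul_arrow K lam _
theorem e_mul_d : e K lam Vertex.M * d K lam = d K lam := e_mul_arrow K lam _

/-- The right module `e_i A`, spanned by the paths that end at the vertex `i`. Right `A`-modules are
modules over the opposite algebra. -/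
noncomputable def Proj (i : Vertex) : Submodule (A K lam)ᵐᵒᵖ (A K lam) :=
  Submodule.span (A K lam)ᵐᵒᵖ {e K lam i}

theorem mem_Proj {i : Vertex} {x : A K lam} : x ∈ Proj K lam i ↔ e K lam i * x = x := by
  refine Submodule.mem_span_singleton.trans ⟨?_, fun h => ⟨MulOpposite.op x, h⟩⟩
  rintro ⟨y, rfl⟩
  rw [MulOpposite.smul_eq_mul_unop, ← mul_assoc, e_mul_e]

/-- Left multiplication by an element `g` with `e_j g = g`, as a homomorphism of right modules from
`e_i A` to `e_j A`. -/
noncomputable def leftMul (i : Vertex) {j : Vertex} (g : A K lam) (hg : e K lam j * g = g) :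
    Proj K lam i →ₗ[(A K lam)ᵐᵒᵖ] Proj K lam j where
  toFun x := ⟨g * x, by rw [mem_Proj, ← mul_assoc, hg]⟩
  map_add' x y := Subtype.ext (mul_add g x y)
  map_smul' r x := Subtype.ext (by simp [MulOpposite.smul_eq_mul_unop, mul_assoc])

/-- The map `e_R A → e_M A` given by `d`. -/
noncomputable def mapD : Proj K lam Vertex.R →ₗ[(A K lam)ᵐᵒᵖ] Proj K lam Vertex.M :=
  leftMul K lam Vertex.R (d K lam) (e_mul_d K lam)

/-- The map `e_M A → e_M A` given by `b² + dc`. -/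
noncomputable def mapB : Proj K lam Vertex.M →ₗ[(A K lam)ᵐᵒᵖ] Proj K lam Vertex.M :=
  leftMul K lam Vertex.M (b K lam ^ 2 + d K lam * c K lam)
    (by rw [mul_add, pow_two, ← mul_assoc, ← mul_assoc, e_mul_b, e_mul_d])

/-- The map `e_M A → e_R A` given by `c`. -/
noncomputable def mapC : Proj K lam Vertex.M →ₗ[(A K lam)ᵐᵒᵖ] Proj K lam Vertex.R :=
  leftMul K lam Vertex.M (c K lam) (e_mul_c K lam)

/-- The character through which `A` acts on the vertex simple at `i`: it sends `e_i` to `1` and the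
other vertex idempotent and all arrows to `0`. -/
noncomputable def char (i : Vertex) : A K lam →ₐ[K] K :=
  RingQuot.liftAlgHom K ⟨PathAlg.vertexChar K i, by
    intro x y h
    induction h <;> simp [pa, pb, pc, pd]⟩

/-- The vertex simple at `i`: the one-dimensional right `A`-module on which `x` acts as the scalar
`char i x`. -/
@[nolint unusedArguments]
def VertexSimple (K : Type u) [Field K] (_lam : K) (_i : Vertex) : Type u := K

noncomputable instance (i : Vertex) : AddCommGroup (VertexSimple K lam i) :=
  inferInstanceAs (AddCommGroup K)

noncomputable instance (i : Vertex) : Module (A K lam)ᵐᵒᵖ (VertexSimple K lam i) :=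
  Module.compHom K ((char K lam i).toRingHom.fromOpposite fun _ _ => mul_comm _ _)

/-- The canonical map `e_i A → L_i`, which sends `e_i` to `1`. -/
noncomputable def aug (i : Vertex) : Proj K lam i →ₗ[(A K lam)ᵐᵒᵖ] VertexSimple K lam i where
  toFun x := char K lam i x
  map_add' x y := map_add (char K lam i) (x : A K lam) y
  map_smul' r x := by
    change char K lam i ((x : A K lam) * r.unop) = char K lam i r.unop * char K lam i x
    rw [map_mul, mul_comm]

end MorrisonPinkham

/-! The algebra has three central elements `centT`, `centV`, `centW`, written t, v, w here, and
finitely many words span it over k[t, v, w]. At M one has a² = w − λt, b² = t and ba = −ab, so 1, a,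
b, ab span a Clifford algebra, whose elements are the `cl`. The element u = b² + dc satisfies u² =
tu, and its anticommutators with a and b are ta + v and tb − w, which are again Clifford elements.
Hence an element of e_R A has the form p·e_R + q·cabd + c·cl, and an element of e_M A has the form
cl + u·cl + cl·d (`exists_normal`).

Right multiplication by e_R and e_M cuts the sequence into two parts. In the e_M-part exactness
follows from dc = u − t, u² = tu and cu = 0. In the e_R-part the formulas `d_z`, `u_cl_d`, `c_cl_d`
show the Koszul complex of t, v, w, which resolves k, plus the contractible summands e_R ↦ d and abd
↦ cabd.

Spanning alone gives exactness at P_R. For the rest, coefficients must be compared, and it suffices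
that d, ad, bd, abd are independent (`IndepD`): the other independence statements follow on
multiplying by d, ad, bd on the right or d on the left. `IndepD` is read off from an explicit
representation on a free module of rank six. -/

namespace MorrisonPinkham

/-! ### Relations between the generators, and the three central elements. -/

/-- Generators of a `K`-algebra that satisfy the relations of the Morrison–Pinkham quiver algebra:
the idempotents `r`, `m` of the vertices `R`, `M`, and the arrows `a`, `b`, `c`, `d`. -/
structure Generators (K : Type u) [Field K] (lam : K) (X : Type v) [Ring X] [Algebra K X] where
  (r m a b c d : X)
  r_r : r * r = r
  m_m : m * m = m
  r_m : r * m = 0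
  m_r : m * r = 0
  r_add_m : r + m = 1
  m_a : m * a = a
  a_m : a * m = a
  m_b : m * b = b
  b_m : b * m = b
  r_c : r * c = c
  c_m : c * m = c
  m_d : m * d = d
  d_r : d * r = d
  b_a : b * a = -(a * b)
  b_b_d : b * (b * d) = -(d * (c * d))
  c_b_b : c * (b * b) = -(c * (d * c))
  a_a : a * a = -(b * (d * c) + d * (c * b) + b * (b * b)) - lam • (b * b)
  adjoin_eq_top : Algebra.adjoin K {r, m, a, b, c, d} = ⊤

namespace Generators

variable {K : Type u} [Field K] {lam : K} {X : Type v} [Ring X] [Algebra K X]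

theorem mul_mul_of_eq {x y z : X} (h : x * y = z) (w : X) : x * (y * w) = z * w := by
  rw [← mul_assoc, h]

theorem mul_mul_mul_of_eq {x y y' z : X} (h : x * (y * y') = z) (w : X) :
    x * (y * (y' * w)) = z * w := by
  rw [← mul_assoc y, ← mul_assoc x, h]

variable (S : Generators K lam X)

theorem r_a : S.r * S.a = 0 := by rw [← S.m_a, mul_mul_of_eq S.r_m, zero_mul]
theorem r_b : S.r * S.b = 0 := by rw [← S.m_b, mul_mul_of_eq S.r_m, zero_mul]
theorem r_d : S.r * S.d = 0 := by rw [← S.m_d, mul_mul_of_eq S.r_m, zero_mul]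
theorem m_c : S.m * S.c = 0 := by rw [← S.r_c, mul_mul_of_eq S.m_r, zero_mul]
theorem a_r : S.a * S.r = 0 := by rw [← S.a_m, mul_assoc, S.m_r, mul_zero]
theorem b_r : S.b * S.r = 0 := by rw [← S.b_m, mul_assoc, S.m_r, mul_zero]
theorem c_r : S.c * S.r = 0 := by rw [← S.c_m, mul_assoc, S.m_r, mul_zero]
theorem d_m : S.d * S.m = 0 := by rw [← S.d_r, mul_assoc, S.r_m, mul_zero]
theorem a_c : S.a * S.c = 0 := by rw [← S.r_c, mul_mul_of_eq S.a_r, zero_mul]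
theorem b_c : S.b * S.c = 0 := by rw [← S.r_c, mul_mul_of_eq S.b_r, zero_mul]
theorem c_c : S.c * S.c = 0 := by
  nth_rewrite 2 [← S.r_c]
  rw [mul_mul_of_eq S.c_r, zero_mul]
theorem d_d : S.d * S.d = 0 := by
  nth_rewrite 2 [← S.m_d]
  rw [mul_mul_of_eq S.d_m, zero_mul]
theorem d_a : S.d * S.a = 0 := by rw [← S.m_a, mul_mul_of_eq S.d_m, zero_mul]
theorem d_b : S.d * S.b = 0 := by rw [← S.m_b, mul_mul_of_eq S.d_m, zero_mul]

theorem a_b_b : S.a * (S.b * S.b) = S.b * (S.b * S.a) := by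
  rw [S.b_a, mul_neg, mul_mul_of_eq S.b_a, neg_mul, neg_neg, mul_assoc]

/-- The central element that is `b²` at `M`. -/
def centT : X := S.b * S.b - S.c * S.d
/-- The central element that is `cad` at `R`. -/
def centV : X :=
  S.a * (S.d * S.c) + S.d * (S.c * S.a) + S.a * (S.b * S.b) + S.c * (S.a * S.d)
/-- The central element that is `a² + λb²` at `M`. -/
def centW : X :=
  -(S.b * (S.d * S.c) + S.d * (S.c * S.b) + S.b * (S.b * S.b)) - S.c * (S.b * S.d)

/-- Left multiplication by this element is the middle map of the resolution. -/
def u : X := S.b * S.b + S.d * S.c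

theorem mem_center_of_commute {x : X} (hr : x * S.r = S.r * x)
    (ha : x * S.a = S.a * x) (hb : x * S.b = S.b * x) (hc : x * S.c = S.c * x)
    (hd : x * S.d = S.d * x) : x ∈ Subalgebra.center K X := by
  have hm : x * S.m = S.m * x := by
    rw [eq_sub_of_add_eq' S.r_add_m, mul_sub, sub_mul, hr, mul_one, one_mul]
  have h : Subalgebra.centralizer K {x} = ⊤ := by
    rw [eq_top_iff, ← S.adjoin_eq_top, Algebra.adjoin_le_iff]
    rintro y (rfl | rfl | rfl | rfl | rfl | rfl) <;>
      simpa [Subalgebra.mem_centralizer_iff, Set.mem_centralizer_iff]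
  rw [Subalgebra.mem_center_iff]
  intro y
  have hy : y ∈ Subalgebra.centralizer K {x} := h ▸ Algebra.mem_top
  exact ((Subalgebra.mem_centralizer_iff K).1 hy x rfl).symm

theorem T_r : S.centT * S.r = -(S.c * S.d) := by
  simp [centT, sub_mul, mul_assoc, S.b_r, S.d_r]
theorem r_T : S.r * S.centT = -(S.c * S.d) := by
  simp [centT, mul_sub, mul_mul_of_eq S.r_b, mul_mul_of_eq S.r_c]
theorem T_m : S.centT * S.m = S.b * S.b := by
  simp [centT, sub_mul, mul_assoc, S.b_m, S.d_m]
theorem V_r : S.centV * S.r = S.c * (S.a * S.d) := by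
  simp [centV, add_mul, mul_assoc, S.a_r, S.b_r, S.c_r, S.d_r]
theorem r_V : S.r * S.centV = S.c * (S.a * S.d) := by
  simp [centV, mul_add, mul_mul_of_eq S.r_a, mul_mul_of_eq S.r_c, mul_mul_of_eq S.r_d]
theorem V_m : S.centV * S.m = S.a * (S.d * S.c) + S.d * (S.c * S.a) + S.a * (S.b * S.b) := by
  simp [centV, add_mul, mul_assoc, S.a_m, S.b_m, S.c_m, S.d_m]
theorem W_r : S.centW * S.r = -(S.c * (S.b * S.d)) := by
  simp [centW, sub_mul, add_mul, mul_assoc, S.b_r, S.c_r, S.d_r]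
theorem r_W : S.r * S.centW = -(S.c * (S.b * S.d)) := by
  simp [centW, mul_sub, mul_add, mul_mul_of_eq S.r_b, mul_mul_of_eq S.r_c, mul_mul_of_eq S.r_d]
theorem W_m : S.centW * S.m =
    -(S.b * (S.d * S.c) + S.d * (S.c * S.b) + S.b * (S.b * S.b)) := by
  simp [centW, sub_mul, add_mul, mul_assoc, S.b_m, S.c_m, S.d_m]

theorem centT_mem : S.centT ∈ Subalgebra.center K X := by
  apply S.mem_center_of_commute
  · rw [S.T_r, S.r_T]
  · simp [centT, sub_mul, mul_sub, mul_assoc, S.d_a, mul_mul_of_eq S.a_c, S.a_b_b]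
  · simp [centT, sub_mul, mul_sub, mul_assoc, S.d_b, mul_mul_of_eq S.b_c]
  · simp [centT, sub_mul, mul_sub, mul_assoc, S.b_c, mul_mul_of_eq S.c_c, S.c_b_b]
  · simp [centT, sub_mul, mul_sub, mul_assoc, S.d_d, S.b_b_d, mul_mul_of_eq S.d_b]

/-- At M this element is a² + λb², and a commutes with b² because it anticommutes with b. -/
theorem centW_mul_a : S.centW * S.a = S.a * S.centW := by
  have h : S.centW * S.m = S.a * S.a + lam • (S.b * S.b) := by rw [W_m, a_a]; abel
  have h' : S.m * S.centW = S.centW * S.m := by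
    rw [W_m]
    simp [centW, mul_sub, mul_add, mul_mul_of_eq S.m_b, mul_mul_of_eq S.m_c, mul_mul_of_eq S.m_d]
  calc S.centW * S.a = S.centW * S.m * S.a := by rw [mul_assoc, S.m_a]
    _ = S.a * (S.centW * S.m) := by
      rw [h]; simp [add_mul, mul_add, mul_assoc, S.a_b_b]
    _ = S.a * S.centW := by rw [← h', ← mul_assoc, S.a_m]

theorem centW_mem : S.centW ∈ Subalgebra.center K X := by
  apply S.mem_center_of_commute
  · rw [S.W_r, S.r_W]
  · exact S.centW_mul_a
  · simp [centW, sub_mul, mul_sub, add_mul, mul_add, mul_assoc, S.d_b, mul_mul_of_eq S.b_c,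
      mul_mul_mul_of_eq S.b_b_d, S.c_b_b]
    abel
  · simp [centW, sub_mul, mul_sub, add_mul, mul_add, mul_assoc, S.b_c, S.c_c, mul_mul_of_eq S.c_c,
      mul_mul_mul_of_eq S.c_b_b]
  · simp [centW, sub_mul, mul_sub, add_mul, mul_add, mul_assoc, S.d_d, mul_mul_of_eq S.d_d,
      mul_mul_of_eq S.d_b, S.b_b_d]

/-- Once each ba is replaced by −ab, this identity says that `centV` commutes with b. -/
theorem centW_mul_a_expand : S.a * (S.b * (S.d * S.c)) + S.a * (S.d * (S.c * S.b)) +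
    S.a * (S.b * (S.b * S.b)) = S.b * (S.d * (S.c * S.a)) + S.d * (S.c * (S.b * S.a)) +
    S.b * (S.b * (S.b * S.a)) := by
  have h := S.centW_mul_a
  simp [centW, sub_mul, mul_sub, add_mul, mul_add, mul_assoc, S.d_a, mul_mul_of_eq S.a_c] at h
  rw [← sub_eq_zero] at h ⊢
  rw [← h]; abel

theorem centV_mem : S.centV ∈ Subalgebra.center K X := by
  apply S.mem_center_of_commute
  · rw [S.V_r, S.r_V]
  -- What has to be seen is that a² commutes with dc. After a² is expanded, this follows from b²d =
  -- −dcd and cb² = −cdc.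
  · simp only [centV, add_mul, mul_add, mul_assoc, S.d_a, mul_mul_of_eq S.a_c, mul_zero, zero_mul,
      ← S.a_b_b]
    simp [mul_mul_of_eq S.a_a, S.a_a, add_mul, mul_add, sub_mul, mul_sub, mul_assoc, S.c_b_b,
      mul_mul_mul_of_eq S.c_b_b, mul_mul_mul_of_eq S.b_b_d]
    abel
  · have h := S.centW_mul_a_expand
    simp only [S.b_a, mul_mul_of_eq S.b_a, mul_neg, neg_mul, neg_neg, mul_assoc] at h
    simp only [centV, add_mul, mul_add, mul_assoc, S.d_b, mul_mul_of_eq S.b_c, mul_mul_of_eq S.b_a,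
      neg_mul, mul_zero, zero_mul, add_zero]
    linear_combination (norm := abel) h
  · simp [centV, add_mul, mul_add, mul_assoc, S.a_c, S.c_c, mul_mul_of_eq S.c_c, S.a_b_b,
      mul_mul_mul_of_eq S.c_b_b]
  · simp [centV, add_mul, mul_add, mul_assoc, S.d_d, mul_mul_of_eq S.d_d, mul_mul_of_eq S.d_a,
      S.b_b_d]

end Generators
end MorrisonPinkham

/-! ### Polynomial scalars and multiplication rules for the Clifford part. -/

namespace MorrisonPinkham

/-- The polynomial ring over which the quiver algebra is a free module of finite rank. -/
abbrev Base (K : Type u) [Field K] : Type u := MvPolynomial (Fin 3) K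

namespace Generators

variable {K : Type u} [Field K] {lam : K} {X : Type v} [Ring X] [Algebra K X]

/-- The homomorphism from the polynomial ring to the center. -/
noncomputable def zeta (S : Generators K lam X) : Base K →ₐ[K] Subalgebra.center K X :=
  MvPolynomial.aeval
    ![⟨S.centT, S.centT_mem⟩, ⟨S.centV, S.centV_mem⟩, ⟨S.centW, S.centW_mem⟩]

/-- A structure of algebra over the polynomial ring in which the variables act as the central
elements `centT`, `centV`, `centW`. -/
structure IsCentral (S : Generators K lam X) [Algebra (Base K) X] : Prop where
  smul_eq (k : K) (x : X) : (MvPolynomial.C k : Base K) • x = k • x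
  t_smul (x : X) : (MvPolynomial.X 0 : Base K) • x = S.centT * x
  v_smul (x : X) : (MvPolynomial.X 1 : Base K) • x = S.centV * x
  w_smul (x : X) : (MvPolynomial.X 2 : Base K) • x = S.centW * x

variable {S : Generators K lam X}

theorem m_u : S.m * S.u = S.u := by
  simp [u, mul_add, mul_mul_of_eq S.m_b, mul_mul_of_eq S.m_d]
theorem u_m : S.u * S.m = S.u := by simp [u, add_mul, mul_assoc, S.b_m, S.c_m]

theorem u_d : S.u * S.d = 0 := by simp [u, add_mul, mul_assoc, S.b_b_d]
theorem c_u : S.c * S.u = 0 := by simp [u, mul_add, S.c_b_b]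

variable [Algebra (Base K) X]

local notation "𝔱" => (MvPolynomial.X 0 : Base K)
local notation "𝔳" => (MvPolynomial.X 1 : Base K)
local notation "𝔴" => (MvPolynomial.X 2 : Base K)
local notation "𝔞" => (MvPolynomial.X 2 - MvPolynomial.C lam * MvPolynomial.X 0 : Base K)

/-- The combination of `e_M`, `a`, `b` and `ab` with the given coefficients. -/
noncomputable def cl (S : Generators K lam X) (p₀ p₁ p₂ p₃ : Base K) : X :=
  p₀ • S.m + p₁ • S.a + p₂ • S.b + p₃ • (S.a * S.b)

section Cl

variable (p₀ p₁ p₂ p₃ : Base K)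

theorem m_cl : S.m * S.cl p₀ p₁ p₂ p₃ = S.cl p₀ p₁ p₂ p₃ := by
  simp only [cl, mul_add, mul_smul_comm, S.m_m, S.m_a, S.m_b, mul_mul_of_eq S.m_a]

theorem cl_m : S.cl p₀ p₁ p₂ p₃ * S.m = S.cl p₀ p₁ p₂ p₃ := by
  simp only [cl, add_mul, smul_mul_assoc, S.m_m, S.a_m, S.b_m, mul_assoc]
theorem cl_r : S.cl p₀ p₁ p₂ p₃ * S.r = 0 := by
  simp [cl, add_mul, mul_assoc, S.m_r, S.a_r, S.b_r]
theorem cl_c : S.cl p₀ p₁ p₂ p₃ * S.c = 0 := by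
  simp [cl, add_mul, mul_assoc, S.m_c, S.a_c, S.b_c]

end Cl

namespace IsCentral

variable (h : S.IsCentral)
include h

theorem b_b : S.b * S.b = 𝔱 • S.m := by rw [h.t_smul, S.T_m]
theorem c_d : S.c * S.d = -(𝔱 • S.r) := by rw [h.t_smul, S.T_r, neg_neg]
theorem c_a_d : S.c * (S.a * S.d) = 𝔳 • S.r := by rw [h.v_smul, S.V_r]
theorem c_b_d : S.c * (S.b * S.d) = -(𝔴 • S.r) := by rw [h.w_smul, S.W_r, neg_neg]
theorem d_c : S.d * S.c = S.u - 𝔱 • S.m := by rw [← h.b_b, u]; abel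
theorem a_a : S.a * S.a = 𝔞 • S.m := by
  rw [sub_smul, mul_smul, h.smul_eq, ← h.b_b, h.w_smul, S.W_m, S.a_a]
-- At M, `centV` is au + ua − ta. In the same way `centW` is tb − bu − ub, which gives `b_u`.
theorem a_u : S.a * S.u = -(S.u * S.a) + 𝔱 • S.a + 𝔳 • S.m := by
  rw [h.v_smul, S.V_m, ← S.m_a, ← smul_mul_assoc, ← h.b_b]
  simp only [u, add_mul, mul_add, mul_assoc, S.m_a, S.a_b_b]
  abel
theorem b_u : S.b * S.u = -(S.u * S.b) + 𝔱 • S.b - 𝔴 • S.m := by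
  rw [h.w_smul, S.W_m, ← S.m_b, ← smul_mul_assoc, ← h.b_b]
  simp only [u, add_mul, mul_add, mul_assoc, S.m_b]
  abel
theorem u_a : S.u * S.a = -(S.a * S.u) + 𝔱 • S.a + 𝔳 • S.m := by
  rw [h.a_u]; abel
theorem u_b : S.u * S.b = -(S.b * S.u) + 𝔱 • S.b - 𝔴 • S.m := by
  rw [h.b_u]; abel
-- The summand dc of the left factor dies since cu = 0, and the summand b² acts as t.
theorem u_u : S.u * S.u = 𝔱 • S.u := by
  nth_rewrite 1 [u]
  rw [add_mul, mul_assoc, mul_assoc, c_u, mul_zero, add_zero, ← mul_assoc, h.b_b, smul_mul_assoc,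
    m_u]

variable (p₀ p₁ p₂ p₃ : Base K)

theorem cl_a : S.cl p₀ p₁ p₂ p₃ * S.a = S.cl (𝔞 * p₁) p₀ (-(𝔞 * p₃)) (-p₂) := by
  simp only [cl, add_mul, mul_assoc, smul_mul_assoc, S.m_a, S.b_a, mul_neg, mul_mul_of_eq h.a_a,
    h.a_a, S.m_b]
  module

theorem cl_b : S.cl p₀ p₁ p₂ p₃ * S.b = S.cl (𝔱 * p₂) (𝔱 * p₃) p₀ p₁ := by
  simp only [cl, add_mul, mul_assoc, smul_mul_assoc, S.m_b, h.b_b, mul_smul_comm, S.a_m]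
  module

theorem cl_u : S.cl p₀ p₁ p₂ p₃ * S.u = S.u * S.cl p₀ (-p₁) (-p₂) p₃ +
    S.cl (𝔳 * p₁ - 𝔴 * p₂) (𝔱 * p₁ - 𝔴 * p₃) (𝔱 * p₂ - 𝔳 * p₃) 0 := by
  simp only [cl, add_mul, mul_assoc, smul_mul_assoc, m_u, u_m, h.a_u, h.b_u, mul_add, mul_sub,
    mul_neg, mul_smul_comm, mul_mul_of_eq h.a_u, S.a_m, S.m_b, neg_mul]
  module

/-- Moving u to the right until it meets d, where ud = 0, leaves only the anticommutators. The
result is the middle Koszul map; p₀ drops out, and so does the coefficient of abd. -/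
theorem u_cl_d : S.u * (S.cl p₀ p₁ p₂ p₃ * S.d) =
    S.cl (𝔳 * p₁ - 𝔴 * p₂) (𝔱 * p₁ + 𝔴 * p₃) (𝔱 * p₂ + 𝔳 * p₃) 0 * S.d := by
  simp only [cl, add_mul, mul_add, smul_mul_assoc, mul_smul_comm, mul_assoc, S.m_d, u_d,
    mul_mul_of_eq S.m_b, mul_mul_of_eq h.u_a, mul_mul_of_eq h.u_b, sub_mul, neg_mul, mul_zero,
    mul_neg, mul_sub]
  module

/-- The coefficient of e_R is the last Koszul map; abd ↦ cabd splits off. -/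
theorem c_cl_d : S.c * (S.cl p₀ p₁ p₂ p₃ * S.d) =
    (𝔳 * p₁ - 𝔱 * p₀ - 𝔴 * p₂) • S.r + p₃ • (S.c * (S.a * (S.b * S.d))) := by
  simp only [cl, add_mul, mul_add, smul_mul_assoc, mul_smul_comm, mul_assoc, S.m_d, h.c_d,
    h.c_a_d, h.c_b_d]
  module

/-- The first Koszul map, obtained from dc = u − t and `u_cl_d`. -/
theorem d_z : S.d * (S.c * (S.a * (S.b * S.d))) = S.cl 0 𝔴 𝔳 (-𝔱) * S.d := by
  have h' := h.u_cl_d 0 0 0 1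
  simp only [cl, zero_smul, zero_add, one_smul, mul_assoc] at h'
  rw [← mul_assoc, h.d_c, sub_mul, h', smul_mul_assoc, mul_mul_of_eq S.m_a]
  simp only [cl, add_mul, smul_mul_assoc, mul_assoc, add_zero]
  module

theorem z_c : S.c * (S.a * (S.b * S.d)) * S.c = S.c * S.cl 0 (-𝔴) (-𝔳) (-𝔱) := by
  have h' := h.cl_u 0 0 0 1
  simp only [cl, zero_smul, zero_add, one_smul] at h'
  rw [mul_assoc, mul_assoc, mul_assoc, h.d_c, mul_sub, mul_sub, ← mul_assoc S.a, h', mul_sub,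
    mul_add, ← mul_assoc S.c, c_u]
  simp only [cl, mul_add, mul_smul_comm, S.b_m]
  simp only [mul_zero, zero_mul]
  module

end IsCentral
end Generators
end MorrisonPinkham

/-! ### Exactness of the Koszul complex of three variables. -/

namespace MorrisonPinkham

namespace Base

variable {K : Type u} [Field K]

local notation "𝔱" => (MvPolynomial.X 0 : Base K)
local notation "𝔳" => (MvPolynomial.X 1 : Base K)
local notation "𝔴" => (MvPolynomial.X 2 : Base K)

/-- The substitution of `0` for one variable. -/
noncomputable def kill (i : Fin 3) : Base K →ₐ[K] Base K :=
  MvPolynomial.aeval fun j => if j = i then 0 else MvPolynomial.X j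

theorem exists_eq_mul_add_kill (i : Fin 3) (p : Base K) :
    ∃ q, p = MvPolynomial.X i * q + kill i p := by
  induction p using MvPolynomial.induction_on with
  | C k => exact ⟨0, by simp [kill]⟩
  | add p p' hp hp' =>
    obtain ⟨q, hq⟩ := hp
    obtain ⟨q', hq'⟩ := hp'
    exact ⟨q + q', by rw [map_add]; linear_combination hq + hq'⟩
  | mul_X p j hp =>
    obtain ⟨q, hq⟩ := hp
    by_cases hj : j = i
    · exact ⟨p, by simp [kill, hj, mul_comm]⟩
    · refine ⟨q * MvPolynomial.X j, ?_⟩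
      have : kill i (MvPolynomial.X j : Base K) = MvPolynomial.X j := by simp [kill, hj]
      rw [map_mul, this]
      linear_combination MvPolynomial.X j * hq

/-- Setting the i-th variable to 0 kills the left side but not the j-th variable, so y is divisible
by the i-th variable. -/
theorem exists_of_mul_eq_mul {i j : Fin 3} (hij : i ≠ j) {x y : Base K}
    (h : MvPolynomial.X i * x = MvPolynomial.X j * y) :
    ∃ z, x = MvPolynomial.X j * z ∧ y = MvPolynomial.X i * z := by
  obtain ⟨z, hz⟩ := exists_eq_mul_add_kill i y
  have hi := congrArg (kill i) h
  have h0 : kill i y = 0 := by simpa [kill, hij.symm] using hi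
  rw [h0, add_zero] at hz
  refine ⟨z, mul_left_cancel₀ (MvPolynomial.X_ne_zero i) ?_, hz⟩
  rw [h, hz]
  ring

/-- Exactness of the Koszul complex of the three variables at the second syzygies. -/
theorem exists_of_koszul_two {x y z : Base K} (h₁ : 𝔳 * x = 𝔴 * y) (h₂ : 𝔱 * x = -(𝔴 * z)) :
    ∃ q, x = 𝔴 * q ∧ y = 𝔳 * q ∧ z = -(𝔱 * q) := by
  obtain ⟨q, hx, hy⟩ := exists_of_mul_eq_mul (by decide) h₁
  refine ⟨q, hx, hy, mul_left_cancel₀ (MvPolynomial.X_ne_zero (2 : Fin 3)) ?_⟩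
  rw [hx] at h₂
  linear_combination h₂

/-- Exactness of the Koszul complex of the three variables at the first syzygies. -/
theorem exists_of_koszul_one {x y z : Base K} (h : 𝔳 * y - 𝔱 * x - 𝔴 * z = 0) :
    ∃ p q s, x = 𝔳 * p - 𝔴 * q ∧ y = 𝔱 * p + 𝔴 * s ∧ z = 𝔱 * q + 𝔳 * s := by
  obtain ⟨p, hp⟩ := exists_eq_mul_add_kill 0 y
  obtain ⟨q, hq⟩ := exists_eq_mul_add_kill 0 z
  -- Modulo t only the syzygy of v and w remains.
  have h0 : 𝔳 * kill 0 y = 𝔴 * kill 0 z := by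
    have := congrArg (kill 0) h
    simpa [kill, sub_eq_zero] using this
  obtain ⟨s, hy, hz⟩ := exists_of_mul_eq_mul (by decide) h0
  rw [hy] at hp
  rw [hz] at hq
  refine ⟨p, q, s, mul_left_cancel₀ (MvPolynomial.X_ne_zero (0 : Fin 3)) ?_, hp, hq⟩
  rw [hp, hq] at h
  linear_combination -h

theorem exists_eq_of_constantCoeff_eq_zero {p : Base K}
    (h : MvPolynomial.constantCoeff p = 0) : ∃ x y z, p = 𝔳 * y - 𝔱 * x - 𝔴 * z := by
  obtain ⟨x, hx⟩ := exists_eq_mul_add_kill 0 p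
  obtain ⟨y, hy⟩ := exists_eq_mul_add_kill 1 (kill 0 p)
  obtain ⟨z, hz⟩ := exists_eq_mul_add_kill 2 (kill 1 (kill 0 p))
  -- Killing all three variables in turn is evaluation at the origin, so the last remainder is the
  -- constant coefficient.
  have h0 : (kill 2).comp ((kill 1).comp (kill 0)) =
      (Algebra.ofId K (Base K)).comp (MvPolynomial.aeval fun _ : Fin 3 => (0 : K)) := by
    apply MvPolynomial.algHom_ext
    intro i
    fin_cases i <;> simp [kill]
  have h1 : kill 2 (kill 1 (kill 0 p)) = 0 := by
    have := DFunLike.congr_fun h0 p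
    simpa [h, MvPolynomial.aeval_zero'] using this
  refine ⟨-x, y, -z, ?_⟩
  linear_combination hx + hy + hz + h1

end Base

/-! ### Normal forms. -/

namespace Generators

variable {K : Type u} [Field K] {lam : K} {X : Type v} [Ring X] [Algebra K X]
  {S : Generators K lam X} [Algebra (Base K) X]

local notation "𝔱" => (MvPolynomial.X 0 : Base K)
local notation "𝔳" => (MvPolynomial.X 1 : Base K)
local notation "𝔴" => (MvPolynomial.X 2 : Base K)
local notation "𝔞" => (MvPolynomial.X 2 - MvPolynomial.C lam * MvPolynomial.X 0 : Base K)

theorem cl_add (p₀ p₁ p₂ p₃ q₀ q₁ q₂ q₃ : Base K) :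
    S.cl p₀ p₁ p₂ p₃ + S.cl q₀ q₁ q₂ q₃ = S.cl (p₀ + q₀) (p₁ + q₁) (p₂ + q₂) (p₃ + q₃) := by
  simp only [cl]; module

theorem smul_cl (s p₀ p₁ p₂ p₃ : Base K) :
    s • S.cl p₀ p₁ p₂ p₃ = S.cl (s * p₀) (s * p₁) (s * p₂) (s * p₃) := by
  simp only [cl]; module

theorem cl_zero : S.cl 0 0 0 0 = 0 := by simp [cl]

/-- The part at `R` of a normal form. -/
def IsNormalR (S : Generators K lam X) (x : X) : Prop :=
  ∃ p q k₀ k₁ k₂ k₃ : Base K,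
    x = p • S.r + q • (S.c * (S.a * (S.b * S.d))) + S.c * S.cl k₀ k₁ k₂ k₃

/-- The part at `M` of a normal form. -/
def IsNormalM (S : Generators K lam X) (x : X) : Prop :=
  ∃ p₀ p₁ p₂ p₃ q₀ q₁ q₂ q₃ s₀ s₁ s₂ s₃ : Base K,
    x = S.cl p₀ p₁ p₂ p₃ + S.u * S.cl q₀ q₁ q₂ q₃ + S.cl s₀ s₁ s₂ s₃ * S.d

theorem IsNormalR.add {x y : X} (hx : S.IsNormalR x) (hy : S.IsNormalR y) :
    S.IsNormalR (x + y) := by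
  obtain ⟨p, q, k₀, k₁, k₂, k₃, rfl⟩ := hx
  obtain ⟨p', q', k₀', k₁', k₂', k₃', rfl⟩ := hy
  refine ⟨p + p', q + q', k₀ + k₀', k₁ + k₁', k₂ + k₂', k₃ + k₃', ?_⟩
  rw [← cl_add, mul_add]
  module

theorem IsNormalM.add {x y : X} (hx : S.IsNormalM x) (hy : S.IsNormalM y) :
    S.IsNormalM (x + y) := by
  obtain ⟨p₀, p₁, p₂, p₃, q₀, q₁, q₂, q₃, s₀, s₁, s₂, s₃, rfl⟩ := hx
  obtain ⟨p₀', p₁', p₂', p₃', q₀', q₁', q₂', q₃', s₀', s₁', s₂', s₃', rfl⟩ := hy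
  refine ⟨p₀ + p₀', p₁ + p₁', p₂ + p₂', p₃ + p₃', q₀ + q₀', q₁ + q₁', q₂ + q₂', q₃ + q₃',
    s₀ + s₀', s₁ + s₁', s₂ + s₂', s₃ + s₃', ?_⟩
  simp only [← cl_add, mul_add, add_mul]
  abel

theorem IsNormalR.smul {x : X} (hx : S.IsNormalR x) (s : Base K) : S.IsNormalR (s • x) := by
  obtain ⟨p, q, k₀, k₁, k₂, k₃, rfl⟩ := hx
  refine ⟨s * p, s * q, s * k₀, s * k₁, s * k₂, s * k₃, ?_⟩
  rw [← smul_cl, mul_smul_comm]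
  module

theorem IsNormalM.smul {x : X} (hx : S.IsNormalM x) (s : Base K) : S.IsNormalM (s • x) := by
  obtain ⟨p₀, p₁, p₂, p₃, q₀, q₁, q₂, q₃, s₀, s₁, s₂, s₃, rfl⟩ := hx
  refine ⟨s * p₀, s * p₁, s * p₂, s * p₃, s * q₀, s * q₁, s * q₂, s * q₃, s * s₀, s * s₁,
    s * s₂, s * s₃, ?_⟩
  simp only [← smul_cl, mul_smul_comm, smul_mul_assoc, smul_add]

theorem r_mul_normalR {y : X} (hy : S.IsNormalR y) : S.r * y = y := by
  obtain ⟨p, q, k₀, k₁, k₂, k₃, rfl⟩ := hy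
  simp only [mul_add, mul_smul_comm, S.r_r, mul_mul_of_eq S.r_c]

theorem m_mul_normalM {y : X} (hy : S.IsNormalM y) : S.m * y = y := by
  obtain ⟨p₀, p₁, p₂, p₃, q₀, q₁, q₂, q₃, s₀, s₁, s₂, s₃, rfl⟩ := hy
  simp only [mul_add, mul_mul_of_eq m_u, m_cl, ← mul_assoc]

namespace IsCentral

variable (h : S.IsCentral)
include h

theorem isNormalR_mul {x y : X} (hx : S.IsNormalR x)
    (hy : y ∈ ({S.r, S.m, S.a, S.b, S.c, S.d} : Set X)) : S.IsNormalR (x * y) := by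
  obtain ⟨p, q, k₀, k₁, k₂, k₃, rfl⟩ := hx
  rcases hy with rfl | rfl | rfl | rfl | rfl | rfl
  · refine ⟨p, q, 0, 0, 0, 0, ?_⟩
    simp [add_mul, mul_assoc, S.r_r, S.d_r, cl_r, cl_zero]
  · refine ⟨0, 0, k₀, k₁, k₂, k₃, ?_⟩
    simp [add_mul, mul_assoc, S.r_m, S.d_m, cl_m]
  · refine ⟨0, 0, 𝔞 * k₁, k₀, -(𝔞 * k₃), -k₂, ?_⟩
    simp [add_mul, mul_assoc, S.r_a, S.d_a, h.cl_a]
  · refine ⟨0, 0, 𝔱 * k₂, 𝔱 * k₃, k₀, k₁, ?_⟩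
    simp [add_mul, mul_assoc, S.r_b, S.d_b, h.cl_b]
  -- The terms with q come from `z_c`, those with p from c = c·e_M.
  · refine ⟨0, 0, q * 0 + p * 1, q * -𝔴 + p * 0, q * -𝔳 + p * 0, q * -𝔱 + p * 0, ?_⟩
    rw [← cl_add, ← smul_cl, ← smul_cl, add_mul, add_mul, smul_mul_assoc, smul_mul_assoc, h.z_c,
      mul_assoc, cl_c, S.r_c, mul_add, mul_smul_comm, mul_smul_comm]
    simp [cl, S.c_m, add_comm]
  · refine ⟨𝔳 * k₁ - 𝔱 * k₀ - 𝔴 * k₂, k₃, 0, 0, 0, 0, ?_⟩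
    simp [add_mul, mul_assoc, S.r_d, S.d_d, h.c_cl_d, cl_zero]

theorem isNormalM_mul {x y : X} (hx : S.IsNormalM x)
    (hy : y ∈ ({S.r, S.m, S.a, S.b, S.c, S.d} : Set X)) : S.IsNormalM (x * y) := by
  obtain ⟨p₀, p₁, p₂, p₃, q₀, q₁, q₂, q₃, s₀, s₁, s₂, s₃, rfl⟩ := hx
  rcases hy with rfl | rfl | rfl | rfl | rfl | rfl
  · refine ⟨0, 0, 0, 0, 0, 0, 0, 0, s₀, s₁, s₂, s₃, ?_⟩
    simp [add_mul, mul_assoc, S.d_r, cl_r, cl_zero]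
  · refine ⟨p₀, p₁, p₂, p₃, q₀, q₁, q₂, q₃, 0, 0, 0, 0, ?_⟩
    simp [add_mul, mul_assoc, S.d_m, cl_m, cl_zero]
  · refine ⟨𝔞 * p₁, p₀, -(𝔞 * p₃), -p₂, 𝔞 * q₁, q₀, -(𝔞 * q₃), -q₂, 0, 0, 0, 0, ?_⟩
    simp [add_mul, mul_assoc, S.d_a, h.cl_a, cl_zero]
  · refine ⟨𝔱 * p₂, 𝔱 * p₃, p₀, p₁, 𝔱 * q₂, 𝔱 * q₃, q₀, q₁, 0, 0, 0, 0, ?_⟩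
    simp [add_mul, mul_assoc, S.d_b, h.cl_b, cl_zero]
  -- Since dc = u − t, the product cl·dc is cl·u, given by `cl_u`, minus t·cl.
  · refine ⟨𝔳 * s₁ - 𝔴 * s₂ + -𝔱 * s₀, 𝔱 * s₁ - 𝔴 * s₃ + -𝔱 * s₁, 𝔱 * s₂ - 𝔳 * s₃ + -𝔱 * s₂,
      0 + -𝔱 * s₃, s₀, -s₁, -s₂, s₃, 0, 0, 0, 0, ?_⟩
    rw [← cl_add, ← smul_cl, cl_zero, zero_mul, add_mul, add_mul, mul_assoc, mul_assoc, h.d_c,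
      cl_c, cl_c, mul_sub, h.cl_u, mul_smul_comm, cl_m, mul_zero]
    module
  · refine ⟨0, 0, 0, 0, 0, 0, 0, 0, p₀ + (𝔳 * q₁ - 𝔴 * q₂), p₁ + (𝔱 * q₁ + 𝔴 * q₃),
      p₂ + (𝔱 * q₂ + 𝔳 * q₃), p₃ + 0, ?_⟩
    rw [← cl_add]
    simp [add_mul, mul_assoc, S.d_d, h.u_cl_d, cl_zero]

theorem exists_normal (x : X) : ∃ y z, S.IsNormalR y ∧ S.IsNormalM z ∧ x = y + z := by
  have hx : x ∈ Algebra.adjoin K {S.r, S.m, S.a, S.b, S.c, S.d} := by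
    rw [S.adjoin_eq_top]; trivial
  -- The elements x whose right multiplication preserves both normal forms are closed under
  -- products, which allows induction on x; e_R and e_M are themselves normal.
  suffices H : ∀ w : X, (S.IsNormalR w → S.IsNormalR (w * x)) ∧
      (S.IsNormalM w → S.IsNormalM (w * x)) by
    refine ⟨S.r * x, S.m * x, (H _).1 ⟨1, 0, 0, 0, 0, 0, ?_⟩,
      (H _).2 ⟨1, 0, 0, 0, 0, 0, 0, 0, 0, 0, 0, 0, ?_⟩, ?_⟩
    · simp [cl]
    · simp [cl]
    · rw [← add_mul, S.r_add_m, one_mul]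
  induction hx using Algebra.adjoin_induction with
  | mem y hy => exact fun w => ⟨fun hw => h.isNormalR_mul hw hy, fun hw => h.isNormalM_mul hw hy⟩
  | algebraMap k =>
    intro w
    rw [← Algebra.commutes, ← Algebra.smul_def, ← h.smul_eq]
    exact ⟨fun hw => hw.smul _, fun hw => hw.smul _⟩
  | add y z _ _ hy hz =>
    intro w
    rw [mul_add]
    exact ⟨fun hw => ((hy w).1 hw).add ((hz w).1 hw), fun hw => ((hy w).2 hw).add ((hz w).2 hw)⟩
  | mul y z _ _ hy hz =>
    intro w
    rw [← mul_assoc]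
    exact ⟨fun hw => (hz _).1 ((hy w).1 hw), fun hw => (hz _).2 ((hy w).2 hw)⟩

theorem isNormalR_of_r_mul {x : X} (hx : S.r * x = x) : S.IsNormalR x := by
  obtain ⟨y, z, hy, hz, rfl⟩ := h.exists_normal x
  rw [mul_add, r_mul_normalR hy, ← m_mul_normalM hz, mul_mul_of_eq S.r_m, zero_mul,
    m_mul_normalM hz] at hx
  rw [← hx, add_zero]
  exact hy

theorem isNormalM_of_m_mul {x : X} (hx : S.m * x = x) : S.IsNormalM x := by
  obtain ⟨y, z, hy, hz, rfl⟩ := h.exists_normal x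
  rw [mul_add, m_mul_normalM hz, ← r_mul_normalR hy, mul_mul_of_eq S.m_r, zero_mul,
    r_mul_normalR hy] at hx
  rw [← hx, zero_add]
  exact hz

end IsCentral
end Generators
end MorrisonPinkham

/-! ### Exactness, given the independence of d, ad, bd, abd. -/

namespace MorrisonPinkham
namespace Generators

variable {K : Type u} [Field K] {lam : K} {X : Type v} [Ring X] [Algebra K X]
  {S : Generators K lam X} [Algebra (Base K) X]

local notation "𝔱" => (MvPolynomial.X 0 : Base K)
local notation "𝔳" => (MvPolynomial.X 1 : Base K)
local notation "𝔴" => (MvPolynomial.X 2 : Base K)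
local notation "𝔞" => (MvPolynomial.X 2 - MvPolynomial.C lam * MvPolynomial.X 0 : Base K)

/-- The elements `d`, `ad`, `bd`, `abd` are linearly independent over the polynomial ring. -/
def IndepD (S : Generators K lam X) : Prop :=
  ∀ p₀ p₁ p₂ p₃ : Base K, S.cl p₀ p₁ p₂ p₃ * S.d = 0 → p₀ = 0 ∧ p₁ = 0 ∧ p₂ = 0 ∧ p₃ = 0

namespace IsCentral

variable (h : S.IsCentral)
include h

theorem exists_c_mul_eq (χ : X →ₐ[K] K) (hr : χ S.r = 1) (hc : χ S.c = 0) {x : X}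
    (hx : S.r * x = x) (hχ : χ x = 0) : ∃ y, S.m * y = y ∧ S.c * y = x := by
  obtain ⟨p, q, k₀, k₁, k₂, k₃, rfl⟩ := h.isNormalR_of_r_mul hx
  obtain ⟨x, y, z, hp⟩ := Base.exists_eq_of_constantCoeff_eq_zero
    (p := p - MvPolynomial.C (MvPolynomial.constantCoeff p)) (by simp)
  have e : p • S.r + q • (S.c * (S.a * (S.b * S.d))) + S.c * S.cl k₀ k₁ k₂ k₃ =
      MvPolynomial.constantCoeff p • S.r +
        S.c * (S.cl x y z q * S.d + S.cl k₀ k₁ k₂ k₃) := by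
    rw [mul_add, h.c_cl_d, ← hp, sub_smul, h.smul_eq]
    abel
  rw [e] at hχ ⊢
  -- The character kills every multiple of c, so it sees only the constant coefficient of p.
  have h0 : MvPolynomial.constantCoeff p = 0 := by simpa [hr, hc] using hχ
  refine ⟨S.cl x y z q * S.d + S.cl k₀ k₁ k₂ k₃, ?_, ?_⟩
  · rw [mul_add, ← mul_assoc, m_cl, m_cl]
  · rw [h0, zero_smul, zero_add]

variable (hd : S.IndepD)
include hd

/-- Multiplying on the right by d and by bd reduces the claim to `IndepD`, through `u_cl_d`. -/
theorem eq_zero_of_u_mul_cl {p₀ p₁ p₂ p₃ : Base K} (hp : S.u * S.cl p₀ p₁ p₂ p₃ = 0) :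
    p₀ = 0 ∧ p₁ = 0 ∧ p₂ = 0 ∧ p₃ = 0 := by
  have e₁ := congrArg (· * S.d) hp
  have e₂ := congrArg (· * S.b * S.d) hp
  simp only [mul_assoc, zero_mul] at e₁ e₂
  rw [← mul_assoc _ S.b, h.cl_b] at e₂
  rw [h.u_cl_d] at e₁ e₂
  obtain ⟨-, h₁, h₂, -⟩ := hd _ _ _ _ e₁
  obtain ⟨-, h₃, h₄, -⟩ := hd _ _ _ _ e₂
  have ht : 𝔱 ≠ 0 := MvPolynomial.X_ne_zero 0
  -- Up to sign, this is the determinant of the linear system `h₁`, `h₃` in p₁ and p₃.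
  have hc : 𝔱 ^ 3 - 𝔴 ^ 2 ≠ 0 := by
    intro h0
    have := congrArg (MvPolynomial.eval ![0, 0, (1 : K)]) h0
    simp at this
  have h5 : p₃ = 0 := by
    refine (mul_eq_zero.1 ?_).resolve_left hc
    linear_combination 𝔱 * h₃ - 𝔴 * h₁
  subst h5
  have h6 : p₁ = 0 := (mul_eq_zero.1 (by linear_combination h₁)).resolve_left ht
  have h7 : p₂ = 0 := (mul_eq_zero.1 (by linear_combination h₂)).resolve_left ht
  subst h6
  have h8 : p₀ = 0 := (mul_eq_zero.1 (by linear_combination h₄)).resolve_left ht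
  exact ⟨h8, rfl, h7, rfl⟩

theorem eq_zero_of_d_mul_smul {p q : Base K}
    (hp : S.d * (p • S.r + q • (S.c * (S.a * (S.b * S.d)))) = 0) : p = 0 ∧ q = 0 := by
  rw [mul_add, mul_smul_comm, mul_smul_comm, h.d_z, S.d_r] at hp
  have e : S.cl p (q * 𝔴) (q * 𝔳) (q * -𝔱) * S.d = 0 := by
    rw [← hp]
    simp only [cl, add_mul, smul_mul_assoc, S.m_d]
    module
  obtain ⟨h₁, -, -, h₂⟩ := hd _ _ _ _ e
  exact ⟨h₁, (mul_eq_zero.1 h₂).resolve_right (neg_ne_zero.2 (MvPolynomial.X_ne_zero 0))⟩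

/-- Right multiplication by d, bd, ad makes p₃, p₁, −p₂ in turn the coefficient of cabd. Once these
vanish, the coefficient of e_R is −t·p₀. -/
theorem eq_zero_of_d_mul_c_mul_cl {p₀ p₁ p₂ p₃ : Base K}
    (hp : S.d * (S.c * S.cl p₀ p₁ p₂ p₃) = 0) : p₀ = 0 ∧ p₁ = 0 ∧ p₂ = 0 ∧ p₃ = 0 := by
  have key (q₀ q₁ q₂ q₃ : Base K) (hq : S.d * (S.c * (S.cl q₀ q₁ q₂ q₃ * S.d)) = 0) :
      𝔳 * q₁ - 𝔱 * q₀ - 𝔴 * q₂ = 0 ∧ q₃ = 0 := by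
    rw [h.c_cl_d] at hq
    exact h.eq_zero_of_d_mul_smul hd hq
  have e₁ := congrArg (· * S.d) hp
  have e₂ := congrArg (· * S.b * S.d) hp
  have e₃ := congrArg (· * S.a * S.d) hp
  simp only [mul_assoc, zero_mul] at e₁ e₂ e₃
  rw [← mul_assoc _ S.b, h.cl_b] at e₂
  rw [← mul_assoc _ S.a, h.cl_a] at e₃
  obtain ⟨h₀, h₃⟩ := key _ _ _ _ e₁
  obtain ⟨-, h₁⟩ := key _ _ _ _ e₂
  obtain ⟨-, h₂⟩ := key _ _ _ _ e₃
  rw [neg_eq_zero] at h₂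
  subst h₁ h₂
  exact ⟨(mul_eq_zero.1 (by linear_combination -h₀)).resolve_left
    (MvPolynomial.X_ne_zero (0 : Fin 3)), rfl, rfl, h₃⟩

theorem eq_zero_of_d_mul {x : X} (hx : S.r * x = x) (hdx : S.d * x = 0) : x = 0 := by
  obtain ⟨p, q, k₀, k₁, k₂, k₃, rfl⟩ := h.isNormalR_of_r_mul hx
  have e₁ := congrArg (· * S.r) hdx
  have e₂ := congrArg (· * S.m) hdx
  simp only [add_mul, mul_assoc, smul_mul_assoc, S.r_r, S.d_r, cl_r, mul_zero, add_zero,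
    zero_mul] at e₁
  simp only [add_mul, mul_assoc, smul_mul_assoc, S.r_m, S.d_m, cl_m, mul_zero, smul_zero, zero_add,
    zero_mul] at e₂
  obtain ⟨rfl, rfl⟩ := h.eq_zero_of_d_mul_smul hd e₁
  obtain ⟨rfl, rfl, rfl, rfl⟩ := h.eq_zero_of_d_mul_c_mul_cl hd e₂
  simp [cl_zero]

theorem eq_of_d_mul_eq {x y : X} (hx : S.r * x = x) (hy : S.r * y = y)
    (hxy : S.d * x = S.d * y) : x = y :=
  sub_eq_zero.1 (h.eq_zero_of_d_mul hd (by rw [mul_sub, hx, hy]) (by rw [mul_sub, hxy, sub_self]))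

theorem exists_d_mul_eq {x : X} (hx : S.m * x = x) (hux : S.u * x = 0) :
    ∃ y, S.r * y = y ∧ S.d * y = x := by
  obtain ⟨p₀, p₁, p₂, p₃, q₀, q₁, q₂, q₃, s₀, s₁, s₂, s₃, rfl⟩ := h.isNormalM_of_m_mul hx
  have e₁ := congrArg (· * S.r) hux
  have e₂ := congrArg (· * S.m) hux
  simp only [add_mul, mul_assoc, S.d_r, cl_r, mul_zero, zero_add, zero_mul] at e₁
  simp only [add_mul, mul_assoc, S.d_m, cl_m, mul_zero, add_zero, zero_mul] at e₂
  rw [mul_add, mul_mul_of_eq h.u_u, smul_mul_assoc, ← mul_smul_comm, ← mul_add, smul_cl,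
    cl_add] at e₂
  -- The e_M-part has p = −tq, so it equals (u − t)·cl(q) = dc·cl(q).
  obtain ⟨h₀, h₁, h₂, h₃⟩ := h.eq_zero_of_u_mul_cl hd e₂
  rw [h.u_cl_d] at e₁
  obtain ⟨g₀, g₁, g₂, -⟩ := hd _ _ _ _ e₁
  -- In the e_R-part s₁, s₂, s₃ form a Koszul cycle, hence a multiple of the coefficients in `d_z`;
  -- s₀ is free because d = d·e_R.
  obtain ⟨q, rfl, rfl, rfl⟩ := Base.exists_of_koszul_two (sub_eq_zero.1 g₀)
    (eq_neg_of_add_eq_zero_left g₁)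
  refine ⟨S.c * S.cl q₀ q₁ q₂ q₃ + (s₀ • S.r + q • (S.c * (S.a * (S.b * S.d)))), ?_, ?_⟩
  · simp only [mul_add, mul_smul_comm, S.r_r, mul_mul_of_eq S.r_c]
  · rw [eq_neg_of_add_eq_zero_left h₀, eq_neg_of_add_eq_zero_left h₁,
      eq_neg_of_add_eq_zero_left h₂, eq_neg_of_add_eq_zero_left h₃]
    rw [mul_add, mul_mul_of_eq h.d_c, sub_mul, smul_mul_assoc, m_cl, mul_add, mul_smul_comm,
      mul_smul_comm, S.d_r, h.d_z]
    simp only [cl, add_mul, smul_mul_assoc, S.m_d]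
    module

theorem exists_u_mul_eq {x : X} (hx : S.m * x = x) (hcx : S.c * x = 0) :
    ∃ y, S.m * y = y ∧ S.u * y = x := by
  obtain ⟨p₀, p₁, p₂, p₃, q₀, q₁, q₂, q₃, s₀, s₁, s₂, s₃, rfl⟩ := h.isNormalM_of_m_mul hx
  -- The extra factor d on the left brings the equation into the form where coefficients are known
  -- to vanish.
  have e₁ := congrArg (S.d * · * S.r) hcx
  have e₂ := congrArg (S.d * · * S.m) hcx
  simp only [add_mul, mul_assoc, S.d_r, cl_r, mul_zero, zero_add, zero_mul] at e₁
  simp only [add_mul, mul_assoc, S.d_m, cl_m, mul_zero, add_zero, zero_mul] at e₂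
  rw [mul_add, mul_mul_of_eq c_u, zero_mul, add_zero] at e₂
  obtain ⟨rfl, rfl, rfl, rfl⟩ := h.eq_zero_of_d_mul_c_mul_cl hd e₂
  rw [h.c_cl_d] at e₁
  obtain ⟨g, rfl⟩ := h.eq_zero_of_d_mul_smul hd e₁
  -- The e_R-part is a Koszul cycle, hence u·cl(0, p, q, s)·d by `u_cl_d`; the e_M-part is already
  -- u·cl(q₀, …, q₃).
  obtain ⟨p, q, s, rfl, rfl, rfl⟩ := Base.exists_of_koszul_one g
  refine ⟨S.cl q₀ q₁ q₂ q₃ + S.cl 0 p q s * S.d, ?_, ?_⟩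
  · rw [mul_add, ← mul_assoc, m_cl, m_cl]
  · rw [mul_add, h.u_cl_d, cl_zero, zero_add]

end IsCentral
end Generators
end MorrisonPinkham

/-! ### An explicit representation that models A e_R. -/

namespace MorrisonPinkham

section Model

variable (K : Type u) [Field K] (lam : K)

local notation "𝔱" => (MvPolynomial.X 0 : Base K)
local notation "𝔳" => (MvPolynomial.X 1 : Base K)
local notation "𝔴" => (MvPolynomial.X 2 : Base K)
local notation "𝔞" => (MvPolynomial.X 2 - MvPolynomial.C lam * MvPolynomial.X 0 : Base K)

/-- The left module `A e_R`, in the basis `e_R`, `cabd`, `d`, `ad`, `bd`, `abd`. -/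
abbrev Model : Type u := Base K × Base K × Base K × Base K × Base K × Base K

/-- The action of the vertices on the model. -/
noncomputable def modelVertex : Vertex → Module.End (Base K) (Model K)
  | Vertex.R =>
    { toFun := fun (p, q, _) => (p, q, 0, 0, 0, 0)
      map_add' := by rintro ⟨_, _, _, _, _, _⟩ ⟨_, _, _, _, _, _⟩; simp
      map_smul' := by rintro _ ⟨_, _, _, _, _, _⟩; simp }
  | Vertex.M =>
    { toFun := fun (_, _, x) => (0, 0, x)
      map_add' := by rintro ⟨_, _, _, _, _, _⟩ ⟨_, _, _, _, _, _⟩; simp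
      map_smul' := by rintro _ ⟨_, _, _, _, _, _⟩; simp }

/-- The action of `a` on the model. -/
noncomputable def modelA : Module.End (Base K) (Model K) where
  toFun := fun (_, _, x₀, x₁, x₂, x₃) => (0, 0, 𝔞 * x₁, x₀, 𝔞 * x₃, x₂)
  map_add' := by rintro ⟨_, _, _, _, _, _⟩ ⟨_, _, _, _, _, _⟩; simp [mul_add]
  map_smul' := by rintro _ ⟨_, _, _, _, _, _⟩; simp [mul_left_comm]

/-- The action of `b` on the model. -/
noncomputable def modelB : Module.End (Base K) (Model K) where
  toFun := fun (_, _, x₀, x₁, x₂, x₃) => (0, 0, 𝔱 * x₂, -(𝔱 * x₃), x₀, -x₁)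
  map_add' := by rintro ⟨_, _, _, _, _, _⟩ ⟨_, _, _, _, _, _⟩; simp [mul_add, add_comm]
  map_smul' := by rintro _ ⟨_, _, _, _, _, _⟩; simp [mul_left_comm]

/-- The action of `c` on the model. -/
noncomputable def modelC : Module.End (Base K) (Model K) where
  toFun := fun (_, _, x₀, x₁, x₂, x₃) => (𝔳 * x₁ - 𝔱 * x₀ - 𝔴 * x₂, x₃, 0, 0, 0, 0)
  map_add' := by rintro ⟨_, _, _, _, _, _⟩ ⟨_, _, _, _, _, _⟩; simp; ring
  map_smul' := by rintro _ ⟨_, _, _, _, _, _⟩; simp; ring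

/-- The action of `d` on the model. -/
noncomputable def modelD : Module.End (Base K) (Model K) where
  toFun := fun (p, q, _) => (0, 0, p, 𝔴 * q, 𝔳 * q, -(𝔱 * q))
  map_add' := by rintro ⟨_, _, _, _, _, _⟩ ⟨_, _, _, _, _, _⟩; simp [mul_add, add_comm]
  map_smul' := by rintro _ ⟨_, _, _, _, _, _⟩; simp [mul_left_comm]

/-- The action of the generators of the path algebra on the model. -/
noncomputable def modelGen : PathGen Vertex → Module.End (Base K) (Model K)
  | PathGen.vertex i => modelVertex K i
  | PathGen.arrow Arrow.a => modelA K lam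
  | PathGen.arrow Arrow.b => modelB K
  | PathGen.arrow Arrow.c => modelC K
  | PathGen.arrow Arrow.d => modelD K

/-- The action of the path algebra on the model. -/
noncomputable def modelPath : P K →ₐ[K] Module.End (Base K) (Model K) :=
  RingQuot.liftAlgHom K ⟨FreeAlgebra.lift K (modelGen K lam), by
    intro x y h
    induction h with
    | idem i =>
      apply LinearMap.ext
      rintro ⟨_, _, _, _, _, _⟩
      cases i <;> simp [modelGen, modelVertex]
    | orth i j h =>
      apply LinearMap.ext
      rintro ⟨_, _, _, _, _, _⟩
      cases i <;> cases j <;> simp [modelGen, modelVertex] at h ⊢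
    | one =>
      have h2 : (Finset.univ : Finset Vertex) = {Vertex.R, Vertex.M} := rfl
      apply LinearMap.ext
      rintro ⟨_, _, _, _, _, _⟩
      rw [h2, Finset.sum_pair (by decide)]
      simp [modelGen, modelVertex]
    | @target i j f =>
      change Arrow i j at f
      apply LinearMap.ext
      rintro ⟨_, _, _, _, _, _⟩
      cases f <;> simp [modelGen, modelVertex, modelA, modelB, modelC, modelD]
    | @source i j f =>
      change Arrow i j at f
      apply LinearMap.ext
      rintro ⟨_, _, _, _, _, _⟩
      cases f <;> simp [modelGen, modelVertex, modelA, modelB, modelC, modelD]⟩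

theorem modelPath_pa : modelPath K lam (pa K) = modelA K lam := by
  simp [modelPath, pa, PathAlg.arrow, modelGen]
theorem modelPath_pb : modelPath K lam (pb K) = modelB K := by
  simp [modelPath, pb, PathAlg.arrow, modelGen]
theorem modelPath_pc : modelPath K lam (pc K) = modelC K := by
  simp [modelPath, pc, PathAlg.arrow, modelGen]
theorem modelPath_pd : modelPath K lam (pd K) = modelD K := by
  simp [modelPath, pd, PathAlg.arrow, modelGen]
theorem modelPath_idem (i : Vertex) : modelPath K lam (PathAlg.idem K i) = modelVertex K i := by
  simp [modelPath, PathAlg.idem, modelGen]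

/-- The action of the quiver algebra on the model. -/
noncomputable def model : A K lam →ₐ[K] Module.End (Base K) (Model K) :=
  RingQuot.liftAlgHom K ⟨modelPath K lam, by
    intro x y h
    have hC (x : Base K) : lam • x = MvPolynomial.C lam * x := MvPolynomial.smul_eq_C_mul x lam
    induction h <;>
    · simp only [map_add, map_mul, map_pow, map_smul, map_zero, modelPath_pa, modelPath_pb,
        modelPath_pc, modelPath_pd]
      apply LinearMap.ext
      rintro ⟨x, y, x₀, x₁, x₂, x₃⟩
      simp [modelA, modelB, modelC, modelD, pow_succ, hC]
      try ring_nf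
      try simp⟩

theorem model_a : model K lam (quo K lam (pa K)) = modelA K lam := by
  simp [model, quo, modelPath_pa]
theorem model_b : model K lam (b K lam) = modelB K := by
  simp [model, b, quo, modelPath_pb]
theorem model_c : model K lam (c K lam) = modelC K := by
  simp [model, c, quo, modelPath_pc]
theorem model_d : model K lam (d K lam) = modelD K := by
  simp [model, d, quo, modelPath_pd]
theorem model_e (i : Vertex) : model K lam (e K lam i) = modelVertex K i := by
  simp [model, e, quo, modelPath_idem]

end Model
end MorrisonPinkham

/-! ### The quiver algebra as an instance, and independence from the model. -/

namespace MorrisonPinkham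

section Instantiation

variable (K : Type u) [Field K] (lam : K)

theorem arrow_mul_e {i j : Vertex} (f : i ⟶ j) :
    quo K lam (PathAlg.arrow K f) * e K lam i = quo K lam (PathAlg.arrow K f) := by
  have h : PathAlg.arrow K f * PathAlg.idem K i = PathAlg.arrow K f := by
    simpa only [PathAlg.idem, PathAlg.arrow, map_mul] using
      RingQuot.mkAlgHom_rel K (PathRel.source (K := K) f)
  simp only [e, ← map_mul, h]

theorem e_mul_e_of_ne {i j : Vertex} (hij : i ≠ j) : e K lam i * e K lam j = 0 := by
  have h : PathAlg.idem K i * PathAlg.idem K j = 0 := by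
    simpa only [PathAlg.idem, map_mul, map_zero] using
      RingQuot.mkAlgHom_rel K (PathRel.orth (K := K) i j hij)
  simp only [e, ← map_mul, h, map_zero]

theorem e_R_add_e_M : e K lam Vertex.R + e K lam Vertex.M = 1 := by
  have h : ∑ i : Vertex, PathAlg.idem K i = 1 := by
    simpa only [PathAlg.idem, map_sum, map_one] using
      RingQuot.mkAlgHom_rel K (PathRel.one (K := K) (V := Vertex))
  have h2 : (Finset.univ : Finset Vertex) = {Vertex.R, Vertex.M} := rfl
  rw [h2, Finset.sum_pair (by decide)] at h
  simp only [e, ← map_add, h, map_one]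

theorem quo_eq_zero {x : P K} (h : Rel K lam x 0) : quo K lam x = 0 := by
  rw [quo, RingQuot.mkAlgHom_rel K h, map_zero]

theorem adjoin_generators_eq_top : Algebra.adjoin K {e K lam Vertex.R, e K lam Vertex.M,
    quo K lam (pa K), b K lam, c K lam, d K lam} = ⊤ := by
  rw [eq_top_iff]
  rintro x -
  obtain ⟨y, rfl⟩ := RingQuot.mkAlgHom_surjective K (Rel K lam) x
  obtain ⟨z, rfl⟩ := RingQuot.mkAlgHom_surjective K (PathRel K Vertex) y
  induction z using FreeAlgebra.induction with
  | grade0 r => simp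
  | grade1 g =>
    apply Algebra.subset_adjoin
    rcases g with (_ | _) | (_ | _ | _ | _)
    exacts [.inl rfl, .inr (.inl rfl), .inr (.inr (.inl rfl)), .inr (.inr (.inr (.inl rfl))),
      .inr (.inr (.inr (.inr (.inl rfl)))), .inr (.inr (.inr (.inr (.inr rfl))))]
  | mul x y hx hy => simpa using Subalgebra.mul_mem _ hx hy
  | add x y hx hy => simpa using Subalgebra.add_mem _ hx hy

/-- The standard generators of the quiver algebra. -/
noncomputable def generators : Generators K lam (A K lam) where
  r := e K lam Vertex.R
  m := e K lam Vertex.M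
  a := quo K lam (pa K)
  b := b K lam
  c := c K lam
  d := d K lam
  r_r := e_mul_e K lam _
  m_m := e_mul_e K lam _
  r_m := e_mul_e_of_ne K lam (by decide)
  m_r := e_mul_e_of_ne K lam (by decide)
  r_add_m := e_R_add_e_M K lam
  m_a := e_mul_arrow K lam _
  a_m := arrow_mul_e K lam _
  m_b := e_mul_arrow K lam _
  b_m := arrow_mul_e K lam _
  r_c := e_mul_arrow K lam _
  c_m := arrow_mul_e K lam _
  m_d := e_mul_arrow K lam _
  d_r := arrow_mul_e K lam _
  b_a := by
    have h := quo_eq_zero K lam Rel.rel_a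
    rw [map_add, map_mul, map_mul] at h
    exact eq_neg_of_add_eq_zero_right (α := A K lam) h
  b_b_d := by
    have h := quo_eq_zero K lam Rel.rel_c
    rw [map_mul, map_add, map_mul, map_pow, add_mul, pow_two, mul_assoc, mul_assoc] at h
    exact eq_neg_of_add_eq_zero_left (G := A K lam) h
  c_b_b := by
    have h := quo_eq_zero K lam Rel.rel_d
    rw [map_mul, map_add, map_mul, map_pow, mul_add, pow_two] at h
    exact eq_neg_of_add_eq_zero_left (G := A K lam) h
  a_a := by
    have h := quo_eq_zero K lam Rel.rel_b
    simp only [map_add, map_mul, map_smul, pow_succ, pow_zero, one_mul, mul_assoc] at h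
    have key {X : Type u} [AddCommGroup X] {x y z s q : X} (h : x + y + z + s + q = 0) :
        x = -(y + z + q) - s := by
      rw [← sub_eq_zero, ← h]
      abel
    exact key (X := A K lam) h
  adjoin_eq_top := adjoin_generators_eq_top K lam

namespace Generators

/-- The structure of algebra over the polynomial ring. -/
noncomputable abbrev algebraBase {K : Type u} [Field K] {lam : K} {X : Type v} [Ring X]
    [Algebra K X] (S : Generators K lam X) : Algebra (Base K) X :=
  ((Subalgebra.center K X).val.comp S.zeta).toRingHom.toAlgebra' fun p x =>
    (Subalgebra.mem_center_iff.1 (S.zeta p).2 x).symm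

theorem isCentral {K : Type u} [Field K] {lam : K} {X : Type v} [Ring X]
    [Algebra K X] (S : Generators K lam X) :
    let _ := S.algebraBase
    S.IsCentral := by
  let _ := S.algebraBase
  have hs (p : Base K) (x : X) : p • x = (S.zeta p : X) * x := rfl
  constructor <;> intros <;> simp [hs, zeta, Algebra.smul_def, ← MvPolynomial.algebraMap_eq]

end Generators

theorem indepD_of_hom {K : Type u} [Field K] {lam : K} {X : Type v} [Ring X]
    [Algebra K X] {S : Generators K lam X} [Algebra (Base K) X] (h : S.IsCentral)
    (ρ : X →ₐ[K] Module.End (Base K) (Model K)) (hm : ρ S.m = modelVertex K Vertex.M)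
    (ha : ρ S.a = modelA K lam)
    (hb : ρ S.b = modelB K) (hc : ρ S.c = modelC K) (hd : ρ S.d = modelD K) : S.IndepD := by
  -- The central elements act on the model as the scalars t, v, w, so ρ is linear over the
  -- polynomial ring.
  have hB : ρ.toRingHom.comp (algebraMap (Base K) X) =
      algebraMap (Base K) (Module.End (Base K) (Model K)) := by
    apply MvPolynomial.ringHom_ext
    · intro k
      have h1 : algebraMap (Base K) X (MvPolynomial.C k) = algebraMap K X k := by
        rw [Algebra.algebraMap_eq_smul_one, h.smul_eq, ← Algebra.algebraMap_eq_smul_one]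
      have h2 : algebraMap (Base K) (Module.End (Base K) (Model K)) (MvPolynomial.C k) =
          algebraMap K _ k := by
        apply LinearMap.ext
        rintro ⟨_, _, _, _, _, _⟩
        simp [Module.algebraMap_end_apply, MvPolynomial.smul_eq_C_mul]
      simp [h1, h2]
    · intro i
      apply LinearMap.ext
      rintro ⟨x, y, x₀, x₁, x₂, x₃⟩
      fin_cases i
      · simp [Algebra.algebraMap_eq_smul_one, h.t_smul, Generators.centT, hb, hc, hd, modelB,
          modelC, modelD]
        ring
      · simp [Algebra.algebraMap_eq_smul_one, h.v_smul, Generators.centV, ha, hb, hc, hd,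
          modelA, modelB, modelC, modelD]
        ring_nf
        simp
      · simp [Algebra.algebraMap_eq_smul_one, h.w_smul, Generators.centW, hb, hc, hd, modelB,
          modelC, modelD]
        ring_nf
        simp
  have hs (p : Base K) (x : X) (y : Model K) : ρ (p • x) y = p • ρ x y := by
    rw [Algebra.smul_def, map_mul, Module.End.mul_apply]
    exact DFunLike.congr_fun (DFunLike.congr_fun hB p) _
  intro p₀ p₁ p₂ p₃ hp
  -- The vector represents e_R; applying cl·d to it gives p₀, …, p₃ as the coordinates along d, ad,
  -- bd, abd.
  have H := DFunLike.congr_fun (congrArg ρ hp) (1, 0, 0, 0, 0, 0)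
  simp only [Generators.cl, add_mul, smul_mul_assoc, map_add, map_mul, map_zero,
    LinearMap.add_apply, hs, Module.End.mul_apply, hm, ha, hb, hd, LinearMap.zero_apply] at H
  simpa [modelA, modelB, modelD, modelVertex] using H

/-- Left multiplication by e_i splits the inclusion of e_i A into the free module A. -/
theorem projective_proj (i : Vertex) : Module.Projective (A K lam)ᵐᵒᵖ (Proj K lam i) := by
  let E : (A K lam)ᵐᵒᵖ ≃ₗ[(A K lam)ᵐᵒᵖ] A K lam :=
    { toFun := MulOpposite.unop
      invFun := MulOpposite.op
      left_inv _ := rfl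
      right_inv _ := rfl
      map_add' _ _ := rfl
      map_smul' _ _ := rfl }
  have : Module.Projective (A K lam)ᵐᵒᵖ (A K lam) := Module.Projective.of_equiv E
  let s : A K lam →ₗ[(A K lam)ᵐᵒᵖ] Proj K lam i :=
    { toFun x := ⟨e K lam i * x, by rw [mem_Proj, ← mul_assoc, e_mul_e]⟩
      map_add' x y := Subtype.ext (mul_add _ x y)
      map_smul' r x := Subtype.ext (by simp [MulOpposite.smul_eq_mul_unop, mul_assoc]) }
  refine Module.Projective.of_split (Proj K lam i).subtype s ?_
  ext x
  exact (mem_Proj K lam).1 x.2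

end Instantiation
end MorrisonPinkham

/-! ### The projective resolution. -/

open MorrisonPinkham in
theorem theorem3 (K : Type*) [Field K] (lam : K) :
    Module.Projective (A K lam)ᵐᵒᵖ (Proj K lam Vertex.R) ∧
    Module.Projective (A K lam)ᵐᵒᵖ (Proj K lam Vertex.M) ∧
    Function.Injective (mapD K lam) ∧
    Function.Exact (mapD K lam) (mapB K lam) ∧
    Function.Exact (mapB K lam) (mapC K lam) ∧
    Function.Exact (mapC K lam) (aug K lam Vertex.R) ∧
    Function.Surjective (aug K lam Vertex.R) := by
  let _ := (generators K lam).algebraBase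
  have h := (generators K lam).isCentral
  have hd := indepD_of_hom h (model K lam) (model_e K lam _) (model_a K lam) (model_b K lam)
    (model_c K lam) (model_d K lam)
  have hu : b K lam ^ 2 + d K lam * c K lam = (generators K lam).u := by rw [pow_two]; rfl
  have hr : char K lam Vertex.R (e K lam Vertex.R) = 1 := by
    simp [char, e, quo]
  have hc : char K lam Vertex.R (c K lam) = 0 := by
    simp [char, c, quo, pc]
  refine ⟨projective_proj K lam _, projective_proj K lam _, ?_, ?_, ?_, ?_, ?_⟩
  · intro x y hxy
    exact Subtype.ext (h.eq_of_d_mul_eq hd ((mem_Proj K lam).1 x.2) ((mem_Proj K lam).1 y.2)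
      (congrArg Subtype.val hxy))
  · intro x
    constructor
    · intro hx
      have hx' : (generators K lam).u * (x : A K lam) = 0 := by
        rw [← hu]; exact congrArg Subtype.val hx
      obtain ⟨y, hy, hyx⟩ := h.exists_d_mul_eq hd ((mem_Proj K lam).1 x.2) hx'
      exact ⟨⟨y, (mem_Proj K lam).2 hy⟩, Subtype.ext hyx⟩
    · rintro ⟨y, rfl⟩
      apply Subtype.ext
      change (b K lam ^ 2 + d K lam * c K lam) * (d K lam * (y : A K lam)) = 0
      rw [hu]
      exact (Generators.mul_mul_of_eq (Generators.u_d (S := generators K lam)) _).trans (zero_mul _)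
  · intro x
    constructor
    · intro hx
      obtain ⟨y, hy, hyx⟩ := h.exists_u_mul_eq hd ((mem_Proj K lam).1 x.2)
        (congrArg Subtype.val hx)
      rw [← hu] at hyx
      exact ⟨⟨y, (mem_Proj K lam).2 hy⟩, Subtype.ext hyx⟩
    · rintro ⟨y, rfl⟩
      apply Subtype.ext
      change c K lam * ((b K lam ^ 2 + d K lam * c K lam) * (y : A K lam)) = 0
      rw [hu]
      exact (Generators.mul_mul_of_eq (Generators.c_u (S := generators K lam)) _).trans (zero_mul _)
  · intro x
    constructor
    · intro hx
      obtain ⟨y, hy, hyx⟩ := h.exists_c_mul_eq (char K lam Vertex.R) hr hc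
        ((mem_Proj K lam).1 x.2) hx
      exact ⟨⟨y, (mem_Proj K lam).2 hy⟩, Subtype.ext hyx⟩
    · rintro ⟨y, rfl⟩
      change char K lam Vertex.R (c K lam * (y : A K lam)) = 0
      rw [map_mul, hc, zero_mul]
  · intro (k : K)
    refine ⟨⟨e K lam Vertex.R * algebraMap K (A K lam) k, ?_⟩, ?_⟩
    · rw [mem_Proj, ← mul_assoc, e_mul_e]
    · change char K lam Vertex.R (e K lam Vertex.R * algebraMap K (A K lam) k) = k
      rw [map_mul, hr, one_mul]
      exact (char K lam Vertex.R).commutes k
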